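/- Let $X$ be the unit interval $[0,1]$ or the unit circle $\mathbb{T}$, and let $A$ be a uniform algebra on $X$, that is, a subalgebra of the algebra $C(X)$ of all continuous complex-valued functions on $X$ which contains the constant functions, separates the points of $X$, and is complete in the uniform norm. For $x\in X$ put $$M_x=\{f\in A: f(x)=0\},\qquad J_x=\{f\in A: f^{-1}(\{0\})\text{ is a neighbourhood of }x\},$$ and let $$E=\{x\in X:\overline{J_x}\neq M_x\},$$ where the closure is taken in the uniform norm; thus $E$ is the set of points at which $A$ is not strongly regular. If $E$ is meagre in $X$ and has no non-empty perfect subset (a perfect set being a closed subset of $X$ without isolated points), then $A=C(X)$. In particular, if $E$ is countable, then $A=C(X)$. -/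

import Mathlib

open scoped Topology

namespace UniformAlgebra

variable {X : Type*} [TopologicalSpace X]

/-- A (unital, complex) subalgebra `A` of `C(X)`, `X` compact, is a uniform algebra on `X` if it
separates the points of `X` and is complete in the uniform norm. Constants belong to `A` because
it is a `ℂ`-subalgebra. -/
structure IsUniformAlgebra [CompactSpace X] (A : Subalgebra ℂ C(X, ℂ)) : Prop where
  separatesPoints : A.SeparatesPoints
  complete : IsComplete (A : Set C(X, ℂ))

/-- The ideal `M_x` of all `f ∈ A` with `f x = 0`. -/
def idealM (A : Subalgebra ℂ C(X, ℂ)) (x : X) : Ideal A where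
  carrier := {f | (f : C(X, ℂ)) x = 0}
  zero_mem' := by simp
  add_mem' := by
    intro f g hf hg
    simp only [Set.mem_ofPred_eq] at hf hg ⊢
    simp [hf, hg]
  smul_mem' := by
    intro c f hf
    simp only [Set.mem_ofPred_eq] at hf ⊢
    simp [hf]

/-- The ideal `J_x` of all `f ∈ A` whose zero set is a neighbourhood of `x`. -/
def idealJ (A : Subalgebra ℂ C(X, ℂ)) (x : X) : Ideal A where
  carrier := {f | {y : X | (f : C(X, ℂ)) y = 0} ∈ 𝓝 x}
  zero_mem' := by simp
  add_mem' := by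
    intro f g hf hg
    simp only [Set.mem_ofPred_eq] at hf hg ⊢
    filter_upwards [hf, hg] with y hy hy'
    simp [hy, hy']
  smul_mem' := by
    intro c f hf
    simp only [Set.mem_ofPred_eq] at hf ⊢
    filter_upwards [hf] with y hy
    simp [hy]

/-- `A` is strongly regular at `x` if the closure of `J_x` in `A`, for the uniform norm,
is `M_x`. -/
def StronglyRegularAt (A : Subalgebra ℂ C(X, ℂ)) (x : X) : Prop :=
  closure (idealJ A x : Set A) = (idealM A x : Set A)

/-- The set `E` of the points of `X` at which `A` is not strongly regular. -/
def exceptionalSet (A : Subalgebra ℂ C(X, ℂ)) : Set X :=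
  {x | ¬ StronglyRegularAt A x}

end UniformAlgebra

/-!
Write `E` for the exceptional set. The hypotheses enter only through two consequences: each closed
subset of `E` is countable (an uncountable one would contain a non-empty perfect set), and the
complement of `E` is dense (by Baire's theorem).

*Normality.* To an ideal `I` attach its hull, the closed set of all `x` with `J_x ≤ I`. If `I` is a
maximal ideal whose hull contains a point `x` outside `E`, then `M_x`, the closure of `J_x`, lies in
`I`. Otherwise the hull `S` is a countable compact set. On such a set the closure of `A` in `C(S)`
is inverse closed, because the spectrum of a function has connected complement, and it follows that
`I` lies in some `M_s` (`exists_le_idealM`). The hull of `M_y` is countable as well: apart from `y`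
it lies in `E`. If it had a second point `x`, an element of `A` close to `0` or `1` on the hull would
split it between `x` and `y`; iterating the polynomial `3 w ^ 2 - 2 w ^ 3` turns this element into a
genuine characteristic function near the hull, which produces a member of `J_x` not vanishing at `y`
(`hull_idealM`). So `A` is regular, and since every maximal ideal lies in some `M_y`, it is normal
(`exists_zero_one`).

*Cutting.* If the boundary of `U` consists of two points outside `E` and `f ∈ A` vanishes there,
then `f` is a limit of functions in `A` vanishing near the boundary, and normality shows that `f`
times the characteristic function of `U` belongs to `A` (`exists_eq_indicator`). On an interval or a
circle this allows `f` to be frozen between two points where it takes the same value. In any small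
arc, choose points `p`, `q` outside `E` and `f ∈ A` with `f p = 0`, `f q = 1` and `|f| ≤ 2` between
them. Freezing yields functions of `A` that climb from `0` to `1` in one small arc and descend in
another, with an absolute bound. Their linear combinations approximate every continuous function
that vanishes at the end points of a parametrization of the space (`mem_of_apply_eq_zero`), and
`A = C(X)` follows.
-/

open scoped Topology

namespace UniformAlgebra

open Set Filter

/-! ### The ideals `M_x`, `J_x` and hulls -/

section Basic

variable {X : Type*} [TopologicalSpace X] {A : Subalgebra ℂ C(X, ℂ)}

theorem mem_idealM {x : X} {f : A} : f ∈ idealM A x ↔ (f : C(X, ℂ)) x = 0 := Iff.rfl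

theorem mem_idealJ {x : X} {f : A} : f ∈ idealJ A x ↔ ∀ᶠ z in 𝓝 x, (f : C(X, ℂ)) z = 0 := Iff.rfl

/-- The hull of an ideal `I` of `A` with respect to the ideals `J_x`: the points `x` such that `I`
contains every function of `A` vanishing near `x`. For maximal `I` this set plays the role of a
support of the corresponding character. -/
def hull (I : Ideal A) : Set X := {x | idealJ A x ≤ I}

theorem mem_hull {I : Ideal A} {x : X} : x ∈ hull I ↔ idealJ A x ≤ I := Iff.rfl

theorem mem_hull_idealM_self (y : X) : y ∈ hull (idealM A y) :=
  fun _ hf => mem_idealM.2 (mem_idealJ.1 hf).self_of_nhds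

theorem isClosed_hull (I : Ideal A) : IsClosed (hull I) := by
  rw [← isOpen_compl_iff, isOpen_iff_mem_nhds]
  intro x hx
  obtain ⟨f, hf, hfI⟩ := SetLike.not_le_iff_exists.1 (mt mem_hull.2 hx)
  filter_upwards [(mem_idealJ.1 hf).eventually_nhds] with z hz
  exact mt mem_hull.1 (SetLike.not_le_iff_exists.2 ⟨f, mem_idealJ.2 hz, hfI⟩)

theorem isClosed_idealM (x : X) : IsClosed (idealM A x : Set A) :=
  isClosed_eq ((continuous_eval_const x).comp continuous_subtype_val) continuous_const

end Basic

/-! ### Maximal ideals with countable hull -/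

/-- A closed subspace of a Banach space that is covered by countably many closed subspaces is
contained in one of them. -/
theorem exists_le_of_subset_iUnion {E : Type*} [NormedAddCommGroup E] [NormedSpace ℂ E]
    [CompleteSpace E] {ι : Type*} [Countable ι] {V : Submodule ℂ E} (hV : IsClosed (V : Set E))
    {W : ι → Submodule ℂ E} (hW : ∀ i, IsClosed (W i : Set E)) (h : ∀ v ∈ V, ∃ i, v ∈ W i) :
    ∃ i, V ≤ W i := by
  have : CompleteSpace V := hV.completeSpace_coe
  have hU : ⋃ i, ((W i).comap V.subtype : Set V) = univ := by
    rw [eq_univ_iff_forall]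
    intro v
    obtain ⟨i, hi⟩ := h v v.2
    exact mem_iUnion.2 ⟨i, hi⟩
  obtain ⟨i, hi⟩ := nonempty_interior_of_iUnion_of_closed
    (fun i => (hW i).preimage continuous_subtype_val) hU
  refine ⟨i, fun v hv => ?_⟩
  have htop := Submodule.eq_top_of_nonempty_interior' ((W i).comap V.subtype) hi
  exact (htop ▸ Submodule.mem_top : (⟨v, hv⟩ : V) ∈ (W i).comap V.subtype)

section General

variable {X : Type*} [MetricSpace X] [CompactSpace X] {A : Subalgebra ℂ C(X, ℂ)}

theorem IsUniformAlgebra.isClosed (hA : IsUniformAlgebra A) : IsClosed (A : Set C(X, ℂ)) :=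
  hA.complete.isClosed

theorem IsUniformAlgebra.completeSpace (hA : IsUniformAlgebra A) : CompleteSpace A :=
  hA.complete.completeSpace_coe

theorem IsUniformAlgebra.exists_of_uniform_approx (hA : IsUniformAlgebra A) {F : X → ℂ}
    (h : ∀ ε > 0, ∃ a ∈ A, ∀ z, ‖a z - F z‖ ≤ ε) : ∃ f ∈ A, ∀ z, f z = F z := by
  have hF : Continuous F := by
    refine continuous_of_uniform_approx_of_continuous fun u hu => ?_
    obtain ⟨ε, hε, hεu⟩ := Metric.mem_uniformity_dist.1 hu
    obtain ⟨a, -, ha⟩ := h (ε / 2) (by positivity)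
    refine ⟨a, a.continuous, fun z => hεu ?_⟩
    rw [dist_comm, dist_eq_norm]
    linarith [ha z]
  refine ⟨⟨F, hF⟩, ?_, fun _ => rfl⟩
  rw [← SetLike.mem_coe, ← hA.isClosed.closure_eq, Metric.mem_closure_iff]
  intro ε hε
  obtain ⟨a, haA, ha⟩ := h (ε / 2) (by positivity)
  refine ⟨a, haA, lt_of_le_of_lt ?_ (half_lt_self hε)⟩
  rw [dist_comm, ContinuousMap.dist_le (by positivity)]
  intro z
  rw [dist_eq_norm]
  exact ha z

theorem IsUniformAlgebra.exists_separating (hA : IsUniformAlgebra A) {x y : X} (hxy : x ≠ y)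
    (a b : ℂ) : ∃ f ∈ A, f x = a ∧ f y = b := by
  obtain ⟨_, ⟨f, hf, rfl⟩, hne⟩ := hA.separatesPoints hxy
  have hne' : f y - f x ≠ 0 := sub_ne_zero.mpr (Ne.symm hne)
  refine ⟨algebraMap ℂ _ a + ((b - a) / (f y - f x)) • (f - algebraMap ℂ _ (f x)),
    A.add_mem (A.algebraMap_mem _) (A.smul_mem (A.sub_mem hf (A.algebraMap_mem _)) _), ?_, ?_⟩
  · simp
  · simp
    field_simp
    ring

/-- `M_x` is the kernel of evaluation at `x`, hence maximal. -/
instance idealM_isMaximal (x : X) : (idealM A x).IsMaximal := by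
  let φ : A →+* ℂ := ((ContinuousMap.evalAlgHom ℂ ℂ x).comp A.val).toRingHom
  have h : idealM A x = RingHom.ker φ := by
    ext f
    rw [mem_idealM, RingHom.mem_ker]
    rfl
  rw [h]
  refine RingHom.ker_isMaximal_of_surjective φ fun c => ⟨algebraMap ℂ A c, ?_⟩
  simp [φ]

/-- A closed set missing the hull of a prime ideal `I` is annihilated, together with a
neighbourhood, by some function outside `I`: a product of finitely many local choices. -/
theorem exists_notMem_of_disjoint_hull {I : Ideal A} [hI : I.IsPrime] {K : Set X} (hK : IsClosed K)
    (h : Disjoint K (hull I)) : ∃ f : A, f ∉ I ∧ ∀ᶠ z in 𝓝ˢ K, (f : C(X, ℂ)) z = 0 := by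
  refine hK.isCompact.induction_on
    (p := fun s => ∃ f : A, f ∉ I ∧ ∀ᶠ z in 𝓝ˢ s, (f : C(X, ℂ)) z = 0) ?_ ?_ ?_ ?_
  · exact ⟨1, (Ideal.ne_top_iff_one I).1 hI.ne_top, by simp⟩
  · rintro s t hst ⟨f, hf, hft⟩
    exact ⟨f, hf, hft.filter_mono (nhdsSet_mono hst)⟩
  · rintro s t ⟨f, hf, hfs⟩ ⟨g, hg, hgt⟩
    refine ⟨f * g, fun hfg => (hI.mem_or_mem hfg).elim hf hg, ?_⟩
    rw [nhdsSet_union, eventually_sup]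
    constructor
    · filter_upwards [hfs] with z hz
      simp [hz]
    · filter_upwards [hgt] with z hz
      simp [hz]
  · intro x hx
    obtain ⟨f, hf, hfI⟩ := SetLike.not_le_iff_exists.1 (mt mem_hull.2 (h.notMem_of_mem_left hx))
    refine ⟨_, mem_nhdsWithin_of_mem_nhds (mem_idealJ.1 hf).eventually_nhds, f, hfI, ?_⟩
    rw [eventually_nhdsSet_iff_forall]
    exact fun z hz => hz

/-- On a countable closed set `S` the closure of `A` in `C(S)` is inverse closed: the range of
`g` on `S` is countable, so its complement is connected and the spectrum of `g` does not grow. -/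
theorem exists_approx_inverse_on_countable {S : Set X} (hSc : IsClosed S) (hS : S.Countable)
    {g : C(X, ℂ)} (hg : g ∈ A) (h0 : ∀ s ∈ S, g s ≠ 0) {ε : ℝ} (hε : 0 < ε) :
    ∃ h ∈ A, ∀ s ∈ S, ‖g s * h s - 1‖ < ε := by
  have : CompactSpace S := isCompact_iff_compactSpace.1 hSc.isCompact
  have : Countable S := hS
  let ρ : C(X, ℂ) →ₐ[ℂ] C(S, ℂ) :=
    ContinuousMap.compRightAlgHom ℂ ℂ (⟨Subtype.val, continuous_subtype_val⟩ : C(S, X))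
  have hρ : ∀ (f : C(X, ℂ)) (s : S), ρ f s = f s := fun _ _ => rfl
  let B : Subalgebra ℂ C(S, ℂ) := (A.map ρ).topologicalClosure
  have hB : IsClosed (B : Set C(S, ℂ)) := Subalgebra.isClosed_topologicalClosure _
  have hgB : ρ g ∈ B := Subalgebra.le_topologicalClosure _ ⟨g, hg, rfl⟩
  have hsp : spectrum ℂ (ρ g) = range (ρ g) := ContinuousMap.spectrum_eq_range _
  have hconn : IsPreconnected (spectrum ℂ ((⟨ρ g, hgB⟩ : B) : C(S, ℂ)))ᶜ := by
    change IsPreconnected (spectrum ℂ (ρ g))ᶜ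
    rw [hsp]
    refine ((countable_range _).isConnected_compl_of_one_lt_rank ?_).isPreconnected
    simp [Complex.rank_real_complex]
  have heq := Subalgebra.spectrum_eq_of_isPreconnected_compl B ⟨ρ g, hgB⟩ hconn
  have hunit : IsUnit (⟨ρ g, hgB⟩ : B) := by
    rw [← spectrum.zero_notMem_iff ℂ, heq]
    change (0 : ℂ) ∉ spectrum ℂ (ρ g)
    rw [hsp]
    rintro ⟨s, hs⟩
    exact h0 s s.2 hs
  obtain ⟨⟨k, hk⟩, hgk⟩ := hunit.exists_right_inv
  have hgk' : ρ g * k = 1 := congrArg Subtype.val hgk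
  have hδ : 0 < ε / (‖ρ g‖ + 1) := by positivity
  obtain ⟨_, ⟨h, hhA, rfl⟩, hh⟩ := Metric.mem_closure_iff.1 hk _ hδ
  refine ⟨h, hhA, fun s hs => ?_⟩
  have e1 : g s * h s - 1 = (ρ g * (ρ h - k)) ⟨s, hs⟩ := by
    rw [mul_sub, hgk']
    rfl
  rw [e1]
  calc ‖(ρ g * (ρ h - k)) ⟨s, hs⟩‖ ≤ ‖ρ g * (ρ h - k)‖ := ContinuousMap.norm_coe_le_norm _ _
    _ ≤ ‖ρ g‖ * ‖ρ h - k‖ := norm_mul_le _ _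
    _ ≤ ‖ρ g‖ * (ε / (‖ρ g‖ + 1)) := by
        gcongr
        rw [← dist_eq_norm, dist_comm]
        exact hh.le
    _ < (‖ρ g‖ + 1) * (ε / (‖ρ g‖ + 1)) := by gcongr; linarith
    _ = ε := by field_simp

theorem tendsto_mul_pow_zero {f k : C(X, ℂ)} (h : ∀ z, f z = 0 ∨ ‖k z‖ ≤ 1 / 2) :
    Tendsto (fun n : ℕ => f * k ^ n) atTop (𝓝 0) := by
  rw [tendsto_zero_iff_norm_tendsto_zero]
  have hz : Tendsto (fun n : ℕ => ‖f‖ * (1 / 2 : ℝ) ^ n) atTop (𝓝 0) := by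
    simpa using (tendsto_pow_atTop_nhds_zero_of_lt_one (r := (1 / 2 : ℝ)) (by norm_num)
      (by norm_num)).const_mul ‖f‖
  refine squeeze_zero (fun _ => norm_nonneg _) (fun n => ?_) hz
  rw [ContinuousMap.norm_le _ (by positivity)]
  intro z
  rw [ContinuousMap.mul_apply, ContinuousMap.pow_apply, norm_mul, norm_pow]
  rcases h z with h0 | h1
  · rw [h0, norm_zero, zero_mul]
    positivity
  · gcongr
    exact ContinuousMap.norm_coe_le_norm f z

/-- If the hull of a maximal ideal `I` is countable, each `g ∈ I` has a zero on it. Otherwise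
`|1 - g h| < 1/2` near the hull for some `h ∈ A`; with `f ∉ I` vanishing off that neighbourhood,
`f (1 - g h) ^ n` tends to `0` while staying congruent to `f` modulo the closed ideal `I`. -/
theorem exists_zero_mem_hull (hA : IsUniformAlgebra A) {I : Ideal A} [hI : I.IsMaximal]
    (hc : (hull I).Countable) {g : A} (hg : g ∈ I) : ∃ s ∈ hull I, (g : C(X, ℂ)) s = 0 := by
  have := hA.completeSpace
  by_contra! h0
  obtain ⟨h, hhA, hh⟩ := exists_approx_inverse_on_countable (isClosed_hull I) hc g.2 h0 one_half_pos
  set k : A := 1 - g * ⟨h, hhA⟩ with hk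
  have hkz : ∀ z, (k : C(X, ℂ)) z = 1 - (g : C(X, ℂ)) z * h z := fun z => by simp [hk]
  have hcl : IsClosed {z | 1 / 2 ≤ ‖(k : C(X, ℂ)) z‖} :=
    isClosed_le continuous_const (k : C(X, ℂ)).continuous.norm
  obtain ⟨f, hfI, hf⟩ := exists_notMem_of_disjoint_hull (I := I) hcl (by
    rw [Set.disjoint_left]
    intro z hz hzI
    have := hh z hzI
    rw [mem_ofPred_eq, hkz, norm_sub_rev] at hz
    linarith)
  apply hfI
  have hcong : ∀ n : ℕ, f - f * k ^ n ∈ I := by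
    intro n
    have h1 : (1 : A) - k ^ n ∈ I := by
      have : (1 - k) ∣ 1 - k ^ n := by simpa using sub_dvd_pow_sub_pow (1 : A) k n
      refine I.mem_of_dvd this ?_
      have : 1 - k = g * ⟨h, hhA⟩ := by rw [hk]; ring
      rw [this]
      exact I.mul_mem_right _ hg
    have := I.mul_mem_left f h1
    rwa [mul_sub, mul_one] at this
  have hlim : Tendsto (fun n : ℕ => f - f * k ^ n) atTop (𝓝 f) := by
    have h0 : Tendsto (fun n : ℕ => f * k ^ n) atTop (𝓝 0) := by
      rw [tendsto_subtype_rng]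
      refine tendsto_mul_pow_zero fun z => ?_
      by_cases hz : 1 / 2 ≤ ‖(k : C(X, ℂ)) z‖
      · exact Or.inl (hf.self_of_nhdsSet z hz)
      · exact Or.inr (not_le.1 hz).le
    simpa using tendsto_const_nhds.sub h0
  exact Ideal.IsMaximal.isClosed.mem_of_tendsto hlim (Eventually.of_forall hcong)

/-- By Baire's theorem all of `I` has a common zero: `I` is the union of the closed subspaces
`I ∩ M_s`, `s ∈ hull I`. -/
theorem exists_le_idealM_of_countable_hull (hA : IsUniformAlgebra A) {I : Ideal A}
    [hI : I.IsMaximal] (hc : (hull I).Countable) : ∃ s, I ≤ idealM A s := by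
  have := hA.completeSpace
  have hIc : IsClosed (I : Set A) := Ideal.IsMaximal.isClosed
  have : Countable (hull I) := hc
  obtain ⟨s, hs⟩ := exists_le_of_subset_iUnion (V := I.restrictScalars ℂ) hIc
    (W := fun s : hull I => (idealM A (s : X)).restrictScalars ℂ)
    (fun s => isClosed_idealM (s : X)) (fun f hf => by
      obtain ⟨s, hs, h0⟩ := exists_zero_mem_hull hA hc hf
      exact ⟨⟨s, hs⟩, h0⟩)
  exact ⟨s, hs⟩

end General

/-! ### Approximate idempotents -/

section Smoothstep

/-- The polynomial `3 w ^ 2 - 2 w ^ 3`. It has superattracting fixed points at `0` and `1`, which it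
exchanges under `w ↦ 1 - w`, so its iterates at an approximate idempotent converge to
an idempotent. -/
def smoothstep {R : Type*} [CommRing R] (w : R) : R := 3 * w ^ 2 - 2 * w ^ 3

theorem norm_smoothstep_le {w : ℂ} (hw : ‖w‖ ≤ 1 / 4) : ‖smoothstep w‖ ≤ 7 / 8 * ‖w‖ := by
  have e : smoothstep w = w * (w * (3 - 2 * w)) := by unfold smoothstep; ring
  have h1 : ‖(3 : ℂ) - 2 * w‖ ≤ 7 / 2 := by
    refine (norm_sub_le _ _).trans ?_
    rw [norm_mul]
    norm_num
    linarith
  rw [e, norm_mul, norm_mul, mul_comm]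
  gcongr
  calc ‖w‖ * ‖(3 : ℂ) - 2 * w‖ ≤ 1 / 4 * (7 / 2) := by gcongr
    _ = 7 / 8 := by norm_num

theorem norm_iterate_smoothstep_le {w : ℂ} (hw : ‖w‖ ≤ 1 / 4) (n : ℕ) :
    ‖smoothstep^[n] w‖ ≤ (7 / 8) ^ n * (1 / 4) := by
  induction n with
  | zero => simpa using hw
  | succ n ih =>
    rw [Function.iterate_succ_apply']
    have h1 : ‖smoothstep^[n] w‖ ≤ 1 / 4 := by
      refine ih.trans ?_
      have : ((7 : ℝ) / 8) ^ n ≤ 1 := pow_le_one₀ (by norm_num) (by norm_num)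
      linarith
    calc _ ≤ 7 / 8 * ‖smoothstep^[n] w‖ := norm_smoothstep_le h1
      _ ≤ 7 / 8 * ((7 / 8) ^ n * (1 / 4)) := by gcongr
      _ = _ := by ring

theorem iterate_smoothstep_one_sub (w : ℂ) (n : ℕ) :
    smoothstep^[n] (1 - w) = 1 - smoothstep^[n] w := by
  induction n with
  | zero => rfl
  | succ n ih =>
    rw [Function.iterate_succ_apply', Function.iterate_succ_apply', ih]
    unfold smoothstep
    ring

theorem norm_iterate_smoothstep_sub_one_le {w : ℂ} (hw : ‖w - 1‖ ≤ 1 / 4) (n : ℕ) :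
    ‖smoothstep^[n] w - 1‖ ≤ (7 / 8) ^ n * (1 / 4) := by
  rw [norm_sub_rev] at hw ⊢
  rw [← iterate_smoothstep_one_sub]
  exact norm_iterate_smoothstep_le hw n

theorem exists_ratio_lt_one {X : Type*} [TopologicalSpace X] {K : Set X} (hK : IsCompact K)
    {a b : C(X, ℂ)} (h : ∀ z ∈ K, ‖b z‖ < ‖a z‖) :
    ∃ r : ℝ, 0 ≤ r ∧ r < 1 ∧ ∀ z ∈ K, ‖b z‖ ≤ r * ‖a z‖ := by
  have hpos : ∀ z ∈ K, 0 < ‖a z‖ := fun z hz => (norm_nonneg _).trans_lt (h z hz)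
  rcases K.eq_empty_or_nonempty with rfl | hne
  · exact ⟨0, le_rfl, one_pos, by simp⟩
  · obtain ⟨z₀, hz₀, hmax⟩ := hK.exists_isMaxOn hne (f := fun z => ‖b z‖ / ‖a z‖)
      (b.continuous.norm.continuousOn.div a.continuous.norm.continuousOn
        fun z hz => (hpos z hz).ne')
    refine ⟨‖b z₀‖ / ‖a z₀‖, by positivity, (div_lt_one (hpos _ hz₀)).2 (h _ hz₀), fun z hz => ?_⟩
    rw [← div_le_iff₀ (hpos z hz)]
    exact hmax hz

/-- If `a + b` is close to `1` and `b` is small relative to `a`, then `a` is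
close to `1` and `b` is close to `0`. -/
theorem norm_sub_one_lt_of_add_near_one {a b : ℂ} (h : ‖a + b - 1‖ < 1 / 16)
    (hb : ‖b‖ ≤ 1 / 16 * ‖a‖) : ‖a - 1‖ < 1 / 4 ∧ ‖b‖ < 1 / 4 := by
  have h1 : ‖a‖ ≤ ‖a + b - 1‖ + ‖b‖ + 1 := by
    calc ‖a‖ = ‖(a + b - 1) - b + 1‖ := by ring_nf
      _ ≤ ‖a + b - 1‖ + ‖b‖ + ‖(1 : ℂ)‖ := (norm_add_le _ _).trans (by gcongr; exact norm_sub_le _ _)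
      _ = _ := by simp
  have h2 : ‖a - 1‖ ≤ ‖a + b - 1‖ + ‖b‖ := by
    calc ‖a - 1‖ = ‖(a + b - 1) - b‖ := by ring_nf
      _ ≤ _ := norm_sub_le _ _
  constructor <;> linarith

end Smoothstep

/-! ### Regularity, normality and cutting -/

section Hull

variable {X : Type*} [MetricSpace X] [CompactSpace X] {A : Subalgebra ℂ C(X, ℂ)}

/-- If `e ∈ A` is close to `0` or to `1` wherever `k ∈ A` does not vanish, then `k` may be replaced
by `0` on the part where `e` is close to `0`. -/
theorem exists_cut_of_approx_idempotent (hA : IsUniformAlgebra A) {k e : C(X, ℂ)} (hk : k ∈ A)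
    (he : e ∈ A) (h : ∀ z, k z = 0 ∨ ‖e z‖ < 1 / 4 ∨ ‖e z - 1‖ < 1 / 4) :
    ∃ F ∈ A, ∀ z, F z = if ‖e z‖ < 1 / 4 then 0 else k z := by
  refine hA.exists_of_uniform_approx fun ε hε => ?_
  obtain ⟨n, hn⟩ := exists_pow_lt_of_lt_one (y := (7 / 8 : ℝ))
    (show 0 < ε / (‖k‖ + 1) by positivity) (by norm_num)
  have hmem : ∀ n : ℕ, smoothstep^[n] e ∈ A ∧ ∀ z, (smoothstep^[n] e) z = smoothstep^[n] (e z) := by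
    intro n
    induction n with
    | zero => exact ⟨he, fun _ => rfl⟩
    | succ n ih =>
      simp only [Function.iterate_succ_apply']
      refine ⟨A.sub_mem (A.mul_mem (A.natCast_mem 3) (A.pow_mem ih.1 _))
        (A.mul_mem (A.natCast_mem 2) (A.pow_mem ih.1 _)), fun z => ?_⟩
      rw [← ih.2 z]
      rfl
  refine ⟨k * smoothstep^[n] e, A.mul_mem hk (hmem n).1, fun z => ?_⟩
  have hb : ‖k z‖ * ((7 / 8) ^ n * (1 / 4)) ≤ ε := by
    have h1 : ‖k z‖ ≤ ‖k‖ + 1 := (ContinuousMap.norm_coe_le_norm k z).trans (by linarith)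
    calc ‖k z‖ * ((7 / 8) ^ n * (1 / 4)) ≤ (‖k‖ + 1) * (ε / (‖k‖ + 1) * 1) := by
          gcongr
          norm_num
      _ = ε := by field_simp
  rw [ContinuousMap.mul_apply, (hmem n).2]
  split_ifs with hz
  · rw [sub_zero, norm_mul]
    exact (mul_le_mul_of_nonneg_left (norm_iterate_smoothstep_le hz.le n) (norm_nonneg _)).trans hb
  · rcases h z with h0 | h0 | h0
    · simp [h0, hε.le]
    · exact absurd h0 hz
    · have e1 : k z * smoothstep^[n] (e z) - k z = k z * (smoothstep^[n] (e z) - 1) := by ring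
      rw [e1, norm_mul]
      exact (mul_le_mul_of_nonneg_left (norm_iterate_smoothstep_sub_one_le h0.le n)
        (norm_nonneg _)).trans hb

/-- A countable closed set `S` can be split by `A` between any two of its points: some `e ∈ A` is
close to `0` or `1` at each point of `S`, close to `0` at `x` and to `1` at `y`. -/
theorem exists_approx_idempotent_on_countable (hA : IsUniformAlgebra A) {S : Set X}
    (hSc : IsClosed S) (hS : S.Countable) {x y : X} (hx : x ∈ S) (hy : y ∈ S) (hxy : x ≠ y) :
    ∃ e ∈ A, (∀ s ∈ S, ‖e s‖ < 1 / 4 ∨ ‖e s - 1‖ < 1 / 4) ∧ ‖e x‖ < 1 / 4 ∧ ‖e y - 1‖ < 1 / 4 := by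
  obtain ⟨f, hf, hfx, hfy⟩ := hA.exists_separating hxy 0 1
  -- A vertical line `re = c` that misses the countable set `f '' S` and separates `f x`, `f y`.
  obtain ⟨c, hcS, hc0, hc1⟩ :=
    ((hS.image fun s => (f s).re).dense_compl ℝ).exists_between (zero_lt_one (α := ℝ))
  have hcS' : ∀ s ∈ S, (f s).re ≠ c := fun s hs h => hcS ⟨s, hs, h⟩
  -- With `u`, `v` as below, `u ^ n / (u ^ n + v ^ n)` is close to `1` to the right of the line and
  -- close to `0` to its left; its poles lie on the line.
  set u : C(X, ℂ) := f - algebraMap ℂ _ (c : ℂ) + 1 with hu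
  set v : C(X, ℂ) := f - algebraMap ℂ _ (c : ℂ) - 1 with hv
  have huA : u ∈ A := A.add_mem (A.sub_mem hf (A.algebraMap_mem _)) A.one_mem
  have hvA : v ∈ A := A.sub_mem (A.sub_mem hf (A.algebraMap_mem _)) A.one_mem
  have hsq : ∀ z, ‖u z‖ ^ 2 - ‖v z‖ ^ 2 = 4 * ((f z).re - c) := by
    intro z
    rw [← Complex.normSq_eq_norm_sq, ← Complex.normSq_eq_norm_sq, Complex.normSq_apply,
      Complex.normSq_apply]
    simp [hu, hv]
    ring
  have hgt : ∀ z, c < (f z).re → ‖v z‖ < ‖u z‖ := fun z hz =>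
    lt_of_pow_lt_pow_left₀ 2 (norm_nonneg _) (by linarith [hsq z])
  have hlt : ∀ z, (f z).re < c → ‖u z‖ < ‖v z‖ := fun z hz =>
    lt_of_pow_lt_pow_left₀ 2 (norm_nonneg _) (by linarith [hsq z])
  have hre : Continuous fun z => (f z).re := Complex.continuous_re.comp f.continuous
  obtain ⟨r₁, hr₁0, hr₁, h₁⟩ := exists_ratio_lt_one
    (hSc.inter (isClosed_le continuous_const hre)).isCompact
    (fun z hz => hgt z (lt_of_le_of_ne hz.2 (hcS' z hz.1).symm))
  obtain ⟨r₂, hr₂0, hr₂, h₂⟩ := exists_ratio_lt_one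
    (hSc.inter (isClosed_le hre continuous_const)).isCompact
    (fun z hz => hlt z (lt_of_le_of_ne hz.2 (hcS' z hz.1)))
  obtain ⟨n, hn⟩ := exists_pow_lt_of_lt_one (show (0 : ℝ) < 1 / 16 by norm_num) (max_lt hr₁ hr₂)
  have hn₁ : r₁ ^ n ≤ 1 / 16 := (pow_le_pow_left₀ hr₁0 (le_max_left _ _) n).trans hn.le
  have hn₂ : r₂ ^ n ≤ 1 / 16 := (pow_le_pow_left₀ hr₂0 (le_max_right _ _) n).trans hn.le
  have hpow : ∀ {r : ℝ} {a b : ℂ}, 0 ≤ r → r ^ n ≤ 1 / 16 → ‖b‖ ≤ r * ‖a‖ →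
      ‖b ^ n‖ ≤ 1 / 16 * ‖a ^ n‖ := by
    intro r a b hr hrn hab
    rw [norm_pow, norm_pow]
    calc ‖b‖ ^ n ≤ (r * ‖a‖) ^ n := by gcongr
      _ = r ^ n * ‖a‖ ^ n := mul_pow _ _ _
      _ ≤ _ := by gcongr
  have hright : ∀ s ∈ S, c < (f s).re → ‖v s ^ n‖ ≤ 1 / 16 * ‖u s ^ n‖ := fun s hs h =>
    hpow hr₁0 hn₁ (h₁ s ⟨hs, h.le⟩)
  have hleft : ∀ s ∈ S, (f s).re < c → ‖u s ^ n‖ ≤ 1 / 16 * ‖v s ^ n‖ := fun s hs h =>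
    hpow hr₂0 hn₂ (h₂ s ⟨hs, h.le⟩)
  have hne : ∀ s ∈ S, (u ^ n + v ^ n) s ≠ 0 := by
    intro s hs h0
    have h0' : ‖u s ^ n‖ = ‖v s ^ n‖ := by
      rw [← norm_neg (v s ^ n)]
      congr 1
      exact eq_neg_of_add_eq_zero_left h0
    rcases lt_or_gt_of_ne (hcS' s hs) with h | h
    · have h3 : 0 < ‖v s ^ n‖ := by
        have := (norm_nonneg _).trans_lt (hlt s h)
        rw [norm_pow]
        positivity
      linarith [hleft s hs h]
    · have h3 : 0 < ‖u s ^ n‖ := by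
        have := (norm_nonneg _).trans_lt (hgt s h)
        rw [norm_pow]
        positivity
      linarith [hright s hs h]
  obtain ⟨h, hhA, hh⟩ := exists_approx_inverse_on_countable hSc hS
    (A.add_mem (A.pow_mem huA n) (A.pow_mem hvA n)) hne (show (0 : ℝ) < 1 / 16 by norm_num)
  have hR : ∀ s ∈ S, c < (f s).re → ‖(u ^ n * h) s - 1‖ < 1 / 4 := by
    intro s hs hcs
    refine (norm_sub_one_lt_of_add_near_one (b := v s ^ n * h s) ?_ ?_).1
    · have := hh s hs
      rwa [ContinuousMap.add_apply, add_mul] at this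
    · change _ ≤ 1 / 16 * ‖u s ^ n * h s‖
      rw [norm_mul, norm_mul, ← mul_assoc]
      gcongr
      exact hright s hs hcs
  have hL : ∀ s ∈ S, (f s).re < c → ‖(u ^ n * h) s‖ < 1 / 4 := by
    intro s hs hcs
    refine (norm_sub_one_lt_of_add_near_one (a := v s ^ n * h s) ?_ ?_).2
    · have := hh s hs
      rwa [ContinuousMap.add_apply, add_mul, add_comm] at this
    · change ‖u s ^ n * h s‖ ≤ _
      rw [norm_mul, norm_mul, ← mul_assoc]
      gcongr
      exact hleft s hs hcs
  refine ⟨u ^ n * h, A.mul_mem (A.pow_mem huA n) hhA, fun s hs => ?_, hL x hx ?_, hR y hy ?_⟩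
  · exact (lt_or_gt_of_ne (hcS' s hs)).imp (hL s hs) (hR s hs)
  · simpa [hfx] using hc0
  · simpa [hfy] using hc1

/-- A proper closed ideal that contains `J_x` equals `M_x` if `A` is strongly regular at `x`. -/
theorem eq_idealM_of_stronglyRegularAt {I : Ideal A} (hI : I ≠ ⊤) (hIc : IsClosed (I : Set A))
    {x : X} (hx : x ∈ hull I) (hsr : StronglyRegularAt A x) : I = idealM A x := by
  refine ((idealM_isMaximal x).eq_of_le hI fun f hf => ?_).symm
  have hf' : f ∈ closure (idealJ A x : Set A) := by
    rw [show closure (idealJ A x : Set A) = _ from hsr]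
    exact hf
  exact closure_minimal (mem_hull.1 hx) hIc hf'

theorem idealM_injective (hA : IsUniformAlgebra A) : Function.Injective (idealM A) := by
  intro x y h
  by_contra hxy
  obtain ⟨f, hf, hfx, hfy⟩ := hA.exists_separating hxy 0 1
  have : (⟨f, hf⟩ : A) ∈ idealM A y := h ▸ mem_idealM.2 hfx
  rw [mem_idealM] at this
  exact one_ne_zero (hfy.symm.trans this)

/-- Apart from `y` itself, the hull of `M_y` consists of exceptional points, so it is a countable
union of closed sets that are countable by assumption. -/
theorem countable_hull_idealM (hA : IsUniformAlgebra A)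
    (hE : ∀ K ⊆ exceptionalSet A, IsClosed K → K.Countable) (y : X) :
    (hull (idealM A y)).Countable := by
  have hsub : hull (idealM A y) ⊆
      {y} ∪ ⋃ n : ℕ, hull (idealM A y) ∩ {z | 1 / ((n : ℝ) + 1) ≤ dist z y} := by
    intro z hz
    rcases eq_or_ne z y with h | h
    · exact Or.inl h
    · obtain ⟨n, hn⟩ := exists_nat_one_div_lt (dist_pos.2 h)
      exact Or.inr (mem_iUnion.2 ⟨n, hz, hn.le⟩)
  refine ((countable_singleton y).union (countable_iUnion fun n => hE _ ?_ ?_)).mono hsub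
  · rintro z ⟨hz, hd⟩ hsr
    have := idealM_injective hA (eq_idealM_of_stronglyRegularAt
      (idealM_isMaximal y).ne_top (isClosed_idealM y) hz hsr)
    rw [mem_ofPred_eq, this, dist_self] at hd
    exact absurd hd (not_le.2 (by positivity))
  · exact (isClosed_hull _).inter (isClosed_le continuous_const (continuous_id.dist continuous_const))

/-- Regularity: no `J_x` with `x ≠ y` is contained in `M_y`. The hull of `M_y` is countable, so an
approximate idempotent splits it between `x` and `y`; cutting a function that lives near the hull
gives an element of `J_x` not vanishing at `y`. -/
theorem hull_idealM (hA : IsUniformAlgebra A)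
    (hE : ∀ K ⊆ exceptionalSet A, IsClosed K → K.Countable) (y : X) :
    hull (idealM A y) = {y} := by
  refine Subset.antisymm (fun x hx => ?_) (by simpa using mem_hull_idealM_self y)
  by_contra hxy
  obtain ⟨e, he, heS, hex, hey⟩ := exists_approx_idempotent_on_countable hA (isClosed_hull _)
    (countable_hull_idealM hA hE y) hx (mem_hull_idealM_self y) hxy
  have hc : IsClosed {z | 1 / 4 ≤ ‖e z‖ ∧ 1 / 4 ≤ ‖e z - 1‖} :=
    (isClosed_le continuous_const e.continuous.norm).inter
      (isClosed_le continuous_const (e.continuous.sub continuous_const).norm)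
  obtain ⟨k, hky, hk⟩ := exists_notMem_of_disjoint_hull (I := idealM A y) hc (by
    rw [Set.disjoint_left]
    rintro z ⟨h1, h2⟩ hz
    rcases heS z hz with h | h <;> linarith)
  obtain ⟨F, hF, hFz⟩ := exists_cut_of_approx_idempotent hA k.2 he (fun z => by
    by_contra! h
    exact h.1 (hk.self_of_nhdsSet z h.2))
  have hFx : (⟨F, hF⟩ : A) ∈ idealJ A x := by
    refine mem_idealJ.2 ?_
    filter_upwards [e.continuous.norm.continuousAt.eventually_lt_const hex] with z hz
    rw [hFz, if_pos hz]
  have hFy : F y = 0 := mem_hull.1 hx hFx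
  have hey' : ¬ ‖e y‖ < 1 / 4 := by
    intro h
    have : ‖(1 : ℂ)‖ ≤ ‖e y‖ + ‖e y - 1‖ := by
      calc ‖(1 : ℂ)‖ = ‖e y - (e y - 1)‖ := by ring_nf
        _ ≤ _ := norm_sub_le _ _
    rw [norm_one] at this
    linarith
  rw [hFz, if_neg hey'] at hFy
  exact hky (mem_idealM.2 hFy)

/-- Each maximal ideal is contained in some `M_s`: its hull either meets the set of points of strong regularity
or is a countable subset of the exceptional set. -/
theorem exists_le_idealM (hA : IsUniformAlgebra A)
    (hE : ∀ K ⊆ exceptionalSet A, IsClosed K → K.Countable) (I : Ideal A) [hI : I.IsMaximal] :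
    ∃ s, I ≤ idealM A s := by
  have := hA.completeSpace
  by_cases h : hull I ⊆ exceptionalSet A
  · exact exists_le_idealM_of_countable_hull hA (hE _ h (isClosed_hull I))
  · obtain ⟨x, hx, hxE⟩ := not_subset.1 h
    exact ⟨x, (eq_idealM_of_stronglyRegularAt hI.ne_top Ideal.IsMaximal.isClosed hx
      (not_not.1 hxE)).le⟩

/-- Normality of `A`: the functions vanishing on `K` and those vanishing on `L` generate an ideal
that lies in no maximal ideal, since by regularity it lies in no `M_y`. -/
theorem exists_zero_one (hA : IsUniformAlgebra A)
    (hE : ∀ K ⊆ exceptionalSet A, IsClosed K → K.Countable) {K L : Set X} (hK : IsClosed K)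
    (hL : IsClosed L) (hKL : Disjoint K L) :
    ∃ u ∈ A, (∀ z ∈ K, u z = 0) ∧ ∀ z ∈ L, u z = 1 := by
  have hreg : ∀ {K : Set X} {y}, IsClosed K → y ∉ K → ¬ (⨅ z ∈ K, idealM A z) ≤ idealM A y := by
    intro K y hK hy hle
    obtain ⟨f, hfy, hf⟩ := exists_notMem_of_disjoint_hull (I := idealM A y) hK (by
      rw [hull_idealM hA hE]
      simpa using hy)
    refine hfy (hle ?_)
    simp only [Submodule.mem_iInf]
    exact fun z hz => mem_idealM.2 (hf.self_of_nhdsSet z hz)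
  have htop : (⨅ z ∈ K, idealM A z) ⊔ (⨅ z ∈ L, idealM A z) = ⊤ := by
    by_contra hne
    obtain ⟨I, hI, hle⟩ := Ideal.exists_le_maximal _ hne
    obtain ⟨y, hy⟩ := exists_le_idealM hA hE I
    by_cases hyK : y ∈ K
    · exact hreg hL (hKL.notMem_of_mem_left hyK) ((le_sup_right.trans hle).trans hy)
    · exact hreg hK hyK ((le_sup_left.trans hle).trans hy)
  obtain ⟨a, ha, b, hb, hab⟩ := Submodule.mem_sup.1 (htop ▸ Submodule.mem_top : (1 : A) ∈ _)
  simp only [Submodule.mem_iInf, mem_idealM] at ha hb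
  refine ⟨a, a.2, ha, fun z hz => ?_⟩
  have := congrArg (fun f : A => (f : C(X, ℂ)) z) hab
  simpa [hb z hz] using this

/-- A function of `A` vanishing at two points of strong regularity is a uniform limit of functions
of `A` vanishing near both. -/
theorem exists_approx_vanishing_near (hA : IsUniformAlgebra A)
    (hE : ∀ K ⊆ exceptionalSet A, IsClosed K → K.Countable) {x y : X} (hxy : x ≠ y)
    (hx : x ∉ exceptionalSet A) (hy : y ∉ exceptionalSet A) {f : C(X, ℂ)} (hf : f ∈ A)
    (hfx : f x = 0) (hfy : f y = 0) {ε : ℝ} (hε : 0 < ε) :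
    ∃ g ∈ A, (∀ z, ‖g z - f z‖ ≤ ε) ∧ (∀ᶠ z in 𝓝 x, g z = 0) ∧ ∀ᶠ z in 𝓝 y, g z = 0 := by
  have approx : ∀ {x}, x ∉ exceptionalSet A → f x = 0 → ∀ {δ : ℝ}, 0 < δ →
      ∃ g ∈ A, (∀ z, ‖g z - f z‖ ≤ δ) ∧ ∀ᶠ z in 𝓝 x, g z = 0 := by
    intro x hx hfx δ hδ
    have hsr : closure (idealJ A x : Set A) = (idealM A x : Set A) := not_not.1 hx
    have hmem : (⟨f, hf⟩ : A) ∈ closure (idealJ A x : Set A) := by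
      rw [hsr]
      exact mem_idealM.2 hfx
    obtain ⟨g, hg, hd⟩ := Metric.mem_closure_iff.1 hmem δ hδ
    refine ⟨g, g.2, fun z => ?_, mem_idealJ.1 hg⟩
    rw [← dist_eq_norm, dist_comm]
    exact (ContinuousMap.dist_apply_le_dist z).trans hd.le
  obtain ⟨r, hr, hdisj⟩ : ∃ r > 0, Disjoint (Metric.closedBall x r) (Metric.closedBall y r) :=
    ⟨dist x y / 3, by have := dist_pos.2 hxy; positivity,
      Metric.closedBall_disjoint_closedBall (by have := dist_pos.2 hxy; linarith)⟩
  obtain ⟨u, huA, hux, huy⟩ :=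
    exists_zero_one hA hE Metric.isClosed_closedBall Metric.isClosed_closedBall hdisj
  obtain ⟨g, hgA, hgf, hgy⟩ := approx hy hfy (show 0 < ε / (‖u‖ + ‖1 - u‖ + 1) by positivity)
  obtain ⟨h, hhA, hhf, hhx⟩ := approx hx hfx (show 0 < ε / (‖u‖ + ‖1 - u‖ + 1) by positivity)
  refine ⟨u * g + (1 - u) * h,
    A.add_mem (A.mul_mem huA hgA) (A.mul_mem (A.sub_mem A.one_mem huA) hhA), fun z => ?_, ?_, ?_⟩
  · have e : (u * g + (1 - u) * h) z - f z = u z * (g z - f z) + (1 - u) z * (h z - f z) := by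
      simp
      ring
    rw [e]
    set δ := ε / (‖u‖ + ‖1 - u‖ + 1)
    calc _ ≤ ‖u z‖ * ‖g z - f z‖ + ‖(1 - u) z‖ * ‖h z - f z‖ := by
          rw [← norm_mul, ← norm_mul]
          exact norm_add_le _ _
      _ ≤ ‖u‖ * δ + ‖1 - u‖ * δ := by
          gcongr
          · exact ContinuousMap.norm_coe_le_norm u z
          · exact hgf z
          · exact ContinuousMap.norm_coe_le_norm (1 - u) z
          · exact hhf z
      _ ≤ (‖u‖ + ‖1 - u‖ + 1) * δ := by
          have : 0 ≤ δ := by positivity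
          linarith
      _ = ε := by
          simp only [δ]
          field_simp
  · filter_upwards [hhx, Metric.closedBall_mem_nhds x hr] with z h1 h2
    simp [h1, hux z h2]
  · filter_upwards [hgy, Metric.closedBall_mem_nhds y hr] with z h1 h2
    simp [h1, huy z h2]

/-- Cutting at two points of strong regularity: a function of `A` that vanishes on the boundary of
`U`, two such points, may be replaced by `0` off `U`. -/
theorem exists_eq_indicator (hA : IsUniformAlgebra A)
    (hE : ∀ K ⊆ exceptionalSet A, IsClosed K → K.Countable) {x y : X} (hxy : x ≠ y)
    (hx : x ∉ exceptionalSet A) (hy : y ∉ exceptionalSet A) {U : Set X}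
    (hU : frontier U ⊆ {x, y}) {f : C(X, ℂ)} (hf : f ∈ A) (hfx : f x = 0) (hfy : f y = 0) :
    ∃ F ∈ A, ∀ z, F z = U.indicator f z := by
  refine hA.exists_of_uniform_approx fun ε hε => ?_
  obtain ⟨g, hgA, hgf, hgx, hgy⟩ := exists_approx_vanishing_near hA hE hxy hx hy hf hfx hfy hε
  set W := interior {z | g z = 0} with hW
  have hxW : x ∈ W := mem_interior_iff_mem_nhds.2 hgx
  have hyW : y ∈ W := mem_interior_iff_mem_nhds.2 hgy
  obtain ⟨u, huA, hu0, hu1⟩ := exists_zero_one hA hE (K := closure Uᶜ \ W) (L := closure U \ W)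
    (isClosed_closure.sdiff isOpen_interior) (isClosed_closure.sdiff isOpen_interior) (by
      rw [Set.disjoint_left]
      rintro z ⟨h1, h2⟩ ⟨h3, -⟩
      have : z ∈ frontier U := by
        rw [frontier_eq_closure_inter_closure]
        exact ⟨h3, h1⟩
      rcases hU this with rfl | rfl
      · exact h2 hxW
      · exact h2 hyW)
  refine ⟨u * g, A.mul_mem huA hgA, fun z => ?_⟩
  have key : (u * g) z = U.indicator g z := by
    by_cases hzW : z ∈ W
    · have : g z = 0 := interior_subset (s := {z | g z = 0}) hzW
      by_cases hzU : z ∈ U <;> simp [hzU, this]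
    · by_cases hzU : z ∈ U
      · simp [hzU, hu1 z ⟨subset_closure hzU, hzW⟩]
      · simp [hzU, hu0 z ⟨subset_closure hzU, hzW⟩]
  rw [key]
  by_cases hzU : z ∈ U
  · simpa [hzU] using hgf z
  · simpa [hzU] using hε.le

end Hull

/-! ### Parametrizations by an interval -/

section Arc

/-- A parametrization `γ` of `X` by `[0, 1]` whose restriction to `(0, 1)` is injective and open and
whose end points are not attained in between; they may coincide. The values of `γ` off `[0, 1]`
play no role. It covers both the interval and the circle. -/
structure IsArcParam {X : Type*} [TopologicalSpace X] (γ : ℝ → X) : Prop where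
  continuous : Continuous γ
  injOn : InjOn γ (Ioo 0 1)
  isOpen_image : ∀ U ⊆ Ioo (0 : ℝ) 1, IsOpen U → IsOpen (γ '' U)
  surj : ∀ x, ∃ t ∈ Icc (0 : ℝ) 1, γ t = x
  zero_notMem : γ 0 ∉ γ '' Ioo 0 1
  one_notMem : γ 1 ∉ γ '' Ioo 0 1

variable {X : Type*} [TopologicalSpace X] {A : Subalgebra ℂ C(X, ℂ)} {γ : ℝ → X}

theorem IsArcParam.mem_image_iff (hγ : IsArcParam γ) {V : Set ℝ} (hV : V ⊆ Ioo 0 1) {t : ℝ}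
    (ht : t ∈ Icc (0 : ℝ) 1) : γ t ∈ γ '' V ↔ t ∈ V := by
  refine ⟨?_, mem_image_of_mem γ⟩
  rintro ⟨s, hs, hst⟩
  have hs' := hV hs
  rcases eq_or_lt_of_le ht.1 with rfl | h0
  · exact absurd ⟨s, hs', hst⟩ hγ.zero_notMem
  rcases eq_or_lt_of_le ht.2 with rfl | h1
  · exact absurd ⟨s, hs', hst⟩ hγ.one_notMem
  exact hγ.injOn hs' ⟨h0, h1⟩ hst ▸ hs

theorem IsArcParam.frontier_image_Icc_subset [T2Space X] (hγ : IsArcParam γ) {p q : ℝ} (hp : 0 < p)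
    (hq : q < 1) : frontier (γ '' Icc p q) ⊆ {γ p, γ q} := by
  have hcl : IsClosed (γ '' Icc p q) := (isCompact_Icc.image hγ.continuous).isClosed
  rw [hcl.frontier_eq]
  rintro _ ⟨⟨t, ht, rfl⟩, hti⟩
  rcases eq_or_lt_of_le ht.1 with rfl | h0
  · exact Or.inl rfl
  rcases eq_or_lt_of_le ht.2 with rfl | h1
  · exact Or.inr rfl
  refine absurd ?_ hti
  have hsub : Ioo p q ⊆ Ioo (0 : ℝ) 1 := Ioo_subset_Ioo hp.le hq.le
  exact interior_maximal (image_mono Ioo_subset_Icc_self)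
    (hγ.isOpen_image _ hsub isOpen_Ioo) ⟨t, ⟨h0, h1⟩, rfl⟩

theorem IsArcParam.exists_mem_of_dense (hγ : IsArcParam γ) {D : Set X} (hD : Dense D) {U : Set ℝ}
    (hU : IsOpen U) (hsub : U ⊆ Ioo 0 1) (hne : U.Nonempty) : ∃ t ∈ U, γ t ∈ D := by
  obtain ⟨_, ⟨t, ht, rfl⟩, htD⟩ :=
    hD.inter_open_nonempty _ (hγ.isOpen_image U hsub hU) (hne.image γ)
  exact ⟨t, ht, htD⟩

/-- `φ` agrees on `[0, 1]` with a function of `A` read through the parametrization `γ`. -/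
def IsPullback (A : Subalgebra ℂ C(X, ℂ)) (γ : ℝ → X) (φ : ℝ → ℂ) : Prop :=
  ∃ F ∈ A, ∀ t ∈ Icc (0 : ℝ) 1, F (γ t) = φ t

namespace IsPullback

variable {φ ψ : ℝ → ℂ}

theorem const (c : ℂ) : IsPullback A γ fun _ => c :=
  ⟨algebraMap ℂ _ c, A.algebraMap_mem c, fun _ _ => rfl⟩

theorem add (hφ : IsPullback A γ φ) (hψ : IsPullback A γ ψ) :
    IsPullback A γ fun t => φ t + ψ t := by
  obtain ⟨F, hF, hFφ⟩ := hφ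
  obtain ⟨H, hH, hHψ⟩ := hψ
  exact ⟨F + H, A.add_mem hF hH, fun t ht => by simp [hFφ t ht, hHψ t ht]⟩

theorem sub (hφ : IsPullback A γ φ) (hψ : IsPullback A γ ψ) :
    IsPullback A γ fun t => φ t - ψ t := by
  obtain ⟨F, hF, hFφ⟩ := hφ
  obtain ⟨H, hH, hHψ⟩ := hψ
  exact ⟨F - H, A.sub_mem hF hH, fun t ht => by simp [hFφ t ht, hHψ t ht]⟩

theorem mul (hφ : IsPullback A γ φ) (hψ : IsPullback A γ ψ) :
    IsPullback A γ fun t => φ t * ψ t := by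
  obtain ⟨F, hF, hFφ⟩ := hφ
  obtain ⟨H, hH, hHψ⟩ := hψ
  exact ⟨F * H, A.mul_mem hF hH, fun t ht => by simp [hFφ t ht, hHψ t ht]⟩

theorem sum {ι : Type*} (s : Finset ι) {φ : ι → ℝ → ℂ} (h : ∀ i ∈ s, IsPullback A γ (φ i)) :
    IsPullback A γ fun t => ∑ i ∈ s, φ i t := by
  classical
  induction s using Finset.induction_on with
  | empty => simpa using const 0
  | insert i s hi ih =>
    simp only [Finset.sum_insert hi]
    exact (h i (Finset.mem_insert_self i s)).add
      (ih fun j hj => h j (Finset.mem_insert_of_mem hj))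

theorem congr (hφ : IsPullback A γ φ) (h : ∀ t ∈ Icc (0 : ℝ) 1, φ t = ψ t) : IsPullback A γ ψ := by
  obtain ⟨F, hF, hFφ⟩ := hφ
  exact ⟨F, hF, fun t ht => (hFφ t ht).trans (h t ht)⟩

end IsPullback

/-- `R` climbs from `0` to `1` inside `(a, b)`: it is `0` up to a point `p`, agrees with a function
`f` of the algebra bounded by `2` between `p` and `q`, and is `1` from `q` on, where `p` and `q` are
points of strong regularity. On the circle `R` itself is not a pullback. -/
def IsStep (A : Subalgebra ℂ C(X, ℂ)) (γ : ℝ → X) (a b : ℝ) (R : ℝ → ℂ) : Prop :=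
  ∃ p q : ℝ, ∃ f : ℝ → ℂ, a < p ∧ p < q ∧ q < b ∧ γ p ∉ exceptionalSet A ∧
    γ q ∉ exceptionalSet A ∧ IsPullback A γ f ∧ f p = 0 ∧ f q = 1 ∧ (∀ t ∈ Icc p q, ‖f t‖ ≤ 2) ∧
    (∀ t ≤ p, R t = 0) ∧ (∀ t ∈ Icc p q, R t = f t) ∧ ∀ t, q ≤ t → R t = 1

namespace IsStep

variable {a b : ℝ} {R : ℝ → ℂ}

theorem eq_zero (h : IsStep A γ a b R) {t : ℝ} (ht : t ≤ a) : R t = 0 := by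
  obtain ⟨p, q, f, hap, -, -, -, -, -, -, -, -, h0, -, -⟩ := h
  exact h0 t (ht.trans hap.le)

theorem eq_one (h : IsStep A γ a b R) {t : ℝ} (ht : b ≤ t) : R t = 1 := by
  obtain ⟨p, q, f, -, -, hqb, -, -, -, -, -, -, -, -, h1⟩ := h
  exact h1 t (hqb.le.trans ht)

theorem norm_le (h : IsStep A γ a b R) (t : ℝ) : ‖R t‖ ≤ 2 := by
  obtain ⟨p, q, f, -, -, -, -, -, -, -, -, hf2, h0, h, h1⟩ := h
  rcases le_total t p with hp | hp
  · simp [h0 t hp]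
  · rcases le_total t q with hq | hq
    · rw [h t ⟨hp, hq⟩]
      exact hf2 t ⟨hp, hq⟩
    · simp [h1 t hq]

end IsStep

end Arc

/-! ### Steps and approximation -/

section Approximation

variable {X : Type*} [MetricSpace X] [CompactSpace X] {A : Subalgebra ℂ C(X, ℂ)} {γ : ℝ → X}

theorem IsPullback.indicator (hA : IsUniformAlgebra A)
    (hE : ∀ K ⊆ exceptionalSet A, IsClosed K → K.Countable) (hγ : IsArcParam γ)
    {φ : ℝ → ℂ} (hφ : IsPullback A γ φ) {p q : ℝ} (hp : 0 < p) (hpq : p < q) (hq : q < 1)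
    (hpE : γ p ∉ exceptionalSet A) (hqE : γ q ∉ exceptionalSet A) (hφp : φ p = 0)
    (hφq : φ q = 0) : IsPullback A γ ((Icc p q).indicator φ) := by
  obtain ⟨F, hF, hFφ⟩ := hφ
  have hsub : Icc p q ⊆ Ioo (0 : ℝ) 1 := Icc_subset_Ioo hp hq
  have hp' : p ∈ Ioo (0 : ℝ) 1 := hsub (left_mem_Icc.2 hpq.le)
  have hq' : q ∈ Ioo (0 : ℝ) 1 := hsub (right_mem_Icc.2 hpq.le)
  have hne : γ p ≠ γ q := fun h => hpq.ne (hγ.injOn hp' hq' h)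
  obtain ⟨H, hH, hHF⟩ := exists_eq_indicator hA hE hne hpE hqE
    (hγ.frontier_image_Icc_subset hp hq) hF
    (by rw [hFφ p (Ioo_subset_Icc_self hp'), hφp]) (by rw [hFφ q (Ioo_subset_Icc_self hq'), hφq])
  refine ⟨H, hH, fun t ht => ?_⟩
  rw [hHF]
  by_cases h : t ∈ Icc p q
  · rw [indicator_of_mem h, indicator_of_mem ((hγ.mem_image_iff hsub ht).2 h), hFφ t ht]
  · rw [indicator_of_notMem h, indicator_of_notMem (mt (hγ.mem_image_iff hsub ht).1 h)]

theorem IsStep.exists_isStep (hA : IsUniformAlgebra A) (hD : Dense (exceptionalSet A)ᶜ)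
    (hγ : IsArcParam γ) {a b : ℝ} (ha : 0 ≤ a) (hab : a < b) (hb : b ≤ 1) : ∃ R, IsStep A γ a b R := by
  have hIoo : ∀ {c d : ℝ}, a ≤ c → d ≤ b → Ioo c d ⊆ Ioo 0 1 := fun hc hd =>
    Ioo_subset_Ioo (ha.trans hc) (hd.trans hb)
  obtain ⟨p, hp, hpE⟩ := hγ.exists_mem_of_dense hD isOpen_Ioo (hIoo le_rfl le_rfl)
    (nonempty_Ioo.2 hab)
  obtain ⟨b', hpb', hb'b⟩ := exists_between hp.2
  have hne : γ p ≠ γ b' := fun h => hpb'.ne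
    (hγ.injOn (hIoo le_rfl le_rfl hp) (hIoo le_rfl le_rfl ⟨hp.1.trans hpb', hb'b⟩) h)
  obtain ⟨F, hF, hFp, hFb'⟩ := hA.exists_separating hne 0 1
  have hcont : Continuous fun t => ‖F (γ t)‖ := (F.continuous.comp hγ.continuous).norm
  -- The norm of `F` at `q` is at least half of its maximum on `[p, b']`, attained at `t₀`.
  obtain ⟨t₀, ht₀, hmax⟩ := isCompact_Icc.exists_isMaxOn (nonempty_Icc.2 hpb'.le)
    hcont.continuousOn
  have hpos : 0 < ‖F (γ t₀)‖ := by
    have h : ‖F (γ b')‖ ≤ ‖F (γ t₀)‖ := hmax (right_mem_Icc.2 hpb'.le)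
    rw [hFb', norm_one] at h
    linarith
  have hopen : IsOpen {t | ‖F (γ t₀)‖ / 2 < ‖F (γ t)‖} := isOpen_lt continuous_const hcont
  have ht₀' : t₀ ∈ closure (Ioo p b') := by rwa [closure_Ioo hpb'.ne]
  obtain ⟨q, ⟨hqF, hq⟩, hqE⟩ := hγ.exists_mem_of_dense hD (hopen.inter isOpen_Ioo)
    (inter_subset_right.trans (hIoo hp.1.le hb'b.le))
    (mem_closure_iff.1 ht₀' _ hopen (half_lt_self hpos))
  have hqF' : ‖F (γ t₀)‖ / 2 < ‖F (γ q)‖ := hqF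
  have hFq : F (γ q) ≠ 0 := norm_pos_iff.1 ((half_pos hpos).trans hqF')
  let f : ℝ → ℂ := fun t => (F (γ q))⁻¹ * F (γ t)
  have hfp : f p = 0 := by simp [f, hFp]
  have hfq : f q = 1 := inv_mul_cancel₀ hFq
  refine ⟨fun t => if t ≤ p then 0 else if t ≤ q then f t else 1, p, q, f, hp.1, hq.1,
    hq.2.trans hb'b, hpE, hqE, (IsPullback.const _).mul ⟨F, hF, fun _ _ => rfl⟩, hfp, hfq,
    fun t ht => ?_, fun t ht => if_pos ht, fun t ht => ?_, fun t ht => ?_⟩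
  · have h : ‖F (γ t)‖ ≤ ‖F (γ t₀)‖ := hmax ⟨ht.1, ht.2.trans hq.2.le⟩
    rw [norm_mul, norm_inv, inv_mul_le_iff₀ (norm_pos_iff.2 hFq)]
    linarith
  · rcases eq_or_lt_of_le ht.1 with rfl | h
    · simp [hfp]
    · simp [not_le.2 h, ht.2]
  · rcases eq_or_lt_of_le ht with rfl | h
    · simp [not_le.2 hq.1, hfq]
    · simp [not_le.2 h, not_le.2 (hq.1.trans h)]

/-- The difference of two steps over disjoint intervals is a pullback. Normality provides a
function of `A` that agrees with the difference on the two ramps; cutting it at the four ends of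
the ramps makes it constant elsewhere. -/
theorem IsStep.isPullback_sub (hA : IsUniformAlgebra A)
    (hE : ∀ K ⊆ exceptionalSet A, IsClosed K → K.Countable) (hγ : IsArcParam γ) {a b c d : ℝ}
    {R R' : ℝ → ℂ} (ha : 0 ≤ a) (hbc : b ≤ c) (hd : d ≤ 1) (hR : IsStep A γ a b R)
    (hR' : IsStep A γ c d R') : IsPullback A γ fun t => R t - R' t := by
  obtain ⟨p, q, f, hap, hpq, hqb, hpE, hqE, hf, hfp, hfq, -, hR0, hRf, hR1⟩ := hR
  obtain ⟨r, s, g, hcr, hrs, hsd, hrE, hsE, hg, hgr, hgs, -, hR'0, hR'g, hR'1⟩ := hR'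
  have hqr : q < r := by linarith
  have hp : 0 < p := by linarith
  have hs : s < 1 := by linarith
  have hcl : ∀ u v : ℝ, IsClosed (γ '' Icc u v) := fun u v =>
    (isCompact_Icc.image hγ.continuous).isClosed
  have hps : Icc p s ⊆ Ioo (0 : ℝ) 1 := Icc_subset_Ioo hp hs
  obtain ⟨v, hvA, hv0, hv1⟩ := exists_zero_one hA hE (hcl r s) (hcl p q) (by
    rw [Set.disjoint_left]
    rintro _ ⟨t, ht, rfl⟩ h
    have := (hγ.mem_image_iff ((Icc_subset_Icc_right (by linarith)).trans hps)
      (Ioo_subset_Icc_self (hps ⟨by linarith [ht.1], ht.2⟩))).1 h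
    linarith [this.2, ht.1])
  set w : ℝ → ℂ := fun t => v (γ t) * f t + (1 - v (γ t)) * (1 - g t) with hw
  have hv : IsPullback A γ fun t => v (γ t) := ⟨v, hvA, fun _ _ => rfl⟩
  have hwA : IsPullback A γ w := (hv.mul hf).add (((IsPullback.const 1).sub hv).mul
    ((IsPullback.const 1).sub hg))
  have hwf : ∀ t ∈ Icc p q, w t = f t := fun t ht => by
    simp [hw, hv1 _ (mem_image_of_mem γ ht)]
  have hwg : ∀ t ∈ Icc r s, w t = 1 - g t := fun t ht => by
    simp [hw, hv0 _ (mem_image_of_mem γ ht)]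
  have h1 : IsPullback A γ ((Icc p s).indicator w) := hwA.indicator hA hE hγ hp (by linarith) hs
    hpE hsE (by rw [hwf p (left_mem_Icc.2 hpq.le), hfp])
    (by rw [hwg s (right_mem_Icc.2 hrs.le), hgs, sub_self])
  have h2 := (h1.sub (IsPullback.const 1)).indicator hA hE hγ (p := q) (q := r) (by linarith) hqr
    (by linarith) hqE hrE
    (by rw [indicator_of_mem (show q ∈ Icc p s from ⟨hpq.le, by linarith⟩), hwf q (right_mem_Icc.2 hpq.le), hfq, sub_self])
    (by rw [indicator_of_mem (show r ∈ Icc p s from ⟨by linarith, hrs.le⟩), hwg r (left_mem_Icc.2 hrs.le), hgr]; simp)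
  refine (h1.sub h2).congr fun t _ => ?_
  rcases lt_or_ge t p with htp | htp
  · rw [indicator_of_notMem (fun h => absurd h.1 (by linarith)),
      indicator_of_notMem (fun h => absurd h.1 (by linarith)), hR0 t htp.le, hR'0 t (by linarith)]
  rcases lt_or_ge t q with htq | htq
  · rw [indicator_of_mem (show t ∈ Icc p s from ⟨htp, by linarith⟩),
      indicator_of_notMem (fun h => absurd h.1 (by linarith)), hRf t ⟨htp, htq.le⟩,
      hR'0 t (by linarith), hwf t ⟨htp, htq.le⟩]
  rcases le_or_gt t r with htr | htr
  · rw [indicator_of_mem (show t ∈ Icc q r from ⟨htq, htr⟩), hR1 t htq, hR'0 t htr]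
    ring
  rcases le_or_gt t s with hts | hts
  · rw [indicator_of_mem (show t ∈ Icc p s from ⟨htp, hts⟩), indicator_of_notMem (fun h => absurd h.2 (by linarith)),
      hR1 t htq, hR'g t ⟨htr.le, hts⟩, hwg t ⟨htr.le, hts⟩, sub_zero]
  · rw [indicator_of_notMem (fun h => absurd h.2 (by linarith)),
      indicator_of_notMem (fun h => absurd h.2 (by linarith)), hR1 t htq, hR'1 t hts.le]
    simp

/-- Abel summation for a family of steps, all of which but `R m` sit at `0` or `1`. -/
theorem sum_step_eq {c R : ℕ → ℂ} {m N : ℕ} (hm : m < N) (h1 : ∀ k < m, R k = 1)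
    (h0 : ∀ k < N, m < k → R k = 0) :
    ∑ k ∈ Finset.range N, (c (k + 1) - c k) * R k = c m - c 0 + (c (m + 1) - c m) * R m := by
  induction N, (Nat.succ_le_of_lt hm) using Nat.le_induction with
  | base =>
    rw [Nat.succ_eq_add_one, Finset.sum_range_succ, ← Finset.sum_range_sub c m]
    congr 1
    exact Finset.sum_congr rfl fun k hk => by rw [h1 k (Finset.mem_range.1 hk), mul_one]
  | succ n hn ih =>
    rw [Finset.sum_range_succ, ih hn fun k hk => h0 k (by omega), h0 n (by omega) hn, mul_zero,
      add_zero]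

theorem exists_nat_div_le_of_mem_Icc {N : ℕ} (hN : 0 < N) {t : ℝ} (ht : t ∈ Icc (0 : ℝ) 1) :
    ∃ m < N, (m : ℝ) / N ≤ t ∧ t ≤ ((m : ℝ) + 1) / N := by
  have hN' : (0 : ℝ) < N := by exact_mod_cast hN
  rcases eq_or_lt_of_le ht.2 with rfl | h1
  · refine ⟨N - 1, by omega, ?_, ?_⟩
    · rw [div_le_one hN']
      exact_mod_cast Nat.sub_le N 1
    · rw [Nat.cast_pred hN, sub_add_cancel, div_self hN'.ne']
  · have h0 : 0 ≤ t * N := mul_nonneg ht.1 hN'.le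
    refine ⟨⌊t * N⌋₊, (Nat.floor_lt h0).2 (by nlinarith), ?_, ?_⟩
    · rw [div_le_iff₀ hN']
      exact Nat.floor_le h0
    · rw [le_div_iff₀ hN']
      exact (Nat.lt_floor_add_one _).le

/-- Every continuous function vanishing at both ends of the parametrization is a uniform limit of
linear combinations of steps whose coefficients sum to `0`. -/
theorem mem_of_apply_eq_zero (hA : IsUniformAlgebra A)
    (hE : ∀ K ⊆ exceptionalSet A, IsClosed K → K.Countable) (hD : Dense (exceptionalSet A)ᶜ)
    (hγ : IsArcParam γ) {G : C(X, ℂ)} (h0 : G (γ 0) = 0) (h1 : G (γ 1) = 0) : G ∈ A := by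
  have key : ∀ ε > 0, ∃ F ∈ A, ∀ z, ‖F z - G z‖ ≤ ε := by
    intro ε hε
    have huc : UniformContinuousOn (fun t => G (γ t)) (Icc 0 1) :=
      isCompact_Icc.uniformContinuousOn_of_continuous
        (G.continuous.comp hγ.continuous).continuousOn
    obtain ⟨δ, hδ, hGδ⟩ := Metric.uniformContinuousOn_iff_le.1 huc (ε / 3) (by positivity)
    obtain ⟨n, hn⟩ := exists_nat_one_div_lt hδ
    set N := n + 1 with hNdef
    have hN : 0 < N := n.succ_pos
    have hN' : (0 : ℝ) < N := by exact_mod_cast hN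
    have hNδ : (1 : ℝ) / N < δ := by simpa [hNdef] using hn
    have hstep : ∀ k : ℕ, ∃ R, k < N → IsStep A γ ((k : ℝ) / N) (((k : ℝ) + 1) / N) R := by
      intro k
      by_cases hk : k < N
      · obtain ⟨R, hR⟩ := IsStep.exists_isStep hA hD hγ (a := (k : ℝ) / N) (b := ((k : ℝ) + 1) / N)
          (by positivity) (by gcongr; linarith) (by
            rw [div_le_one hN']
            exact_mod_cast hk)
        exact ⟨R, fun _ => hR⟩
      · exact ⟨0, fun h => absurd h hk⟩
    choose R hR using hstep
    set c : ℕ → ℂ := fun k => G (γ ((k : ℝ) / N)) with hc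
    have hc0 : c 0 = 0 := by simp [hc, h0]
    have hcN : c N = 0 := by simp [hc, h1, hN'.ne']
    have hpb : IsPullback A γ
        fun t => ∑ k ∈ Finset.range N, (c (k + 1) - c k) * (R k t - R 0 t) := by
      refine IsPullback.sum _ fun k hk => (IsPullback.const _).mul ?_
      have hk' := Finset.mem_range.1 hk
      rcases Nat.eq_zero_or_pos k with rfl | hkpos
      · simpa using IsPullback.const 0
      · have := IsStep.isPullback_sub hA hE hγ (by simp) (by
            gcongr
            have : (1 : ℝ) ≤ k := by exact_mod_cast hkpos
            simpa using this) (by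
            rw [div_le_one hN']
            exact_mod_cast hk') (hR 0 hN) (hR k hk')
        exact ((IsPullback.const 0).sub this).congr fun t _ => by ring
    obtain ⟨F, hF, hFt⟩ := hpb
    refine ⟨F, hF, fun z => ?_⟩
    obtain ⟨t, ht, rfl⟩ := hγ.surj z
    obtain ⟨m, hm, hmt, htm⟩ := exists_nat_div_le_of_mem_Icc hN ht
    have hsum : F (γ t) = c m + (c (m + 1) - c m) * R m t := by
      have e1 : ∑ k ∈ Finset.range N, (c (k + 1) - c k) * (R k t - R 0 t)
          = ∑ k ∈ Finset.range N, (c (k + 1) - c k) * R k t := by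
        simp only [mul_sub, Finset.sum_sub_distrib, ← Finset.sum_mul, Finset.sum_range_sub c N,
          hc0, hcN]
        simp
      rw [(hFt t ht).trans e1, sum_step_eq hm (fun k hk => ?_) (fun k hkN hk => ?_), hc0, sub_zero]
      · refine (hR k (hk.trans hm)).eq_one (le_trans ?_ hmt)
        gcongr
        exact_mod_cast hk
      · refine (hR k hkN).eq_zero (htm.trans ?_)
        gcongr
        exact_mod_cast hk
    have hm1 : ((m : ℝ) + 1) / N ≤ 1 := by
      rw [div_le_one hN']
      exact_mod_cast hm
    have hgap : ((m : ℝ) + 1) / N - m / N = 1 / N := by ring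
    have hmI : (m : ℝ) / N ∈ Icc (0 : ℝ) 1 := ⟨by positivity, hmt.trans ht.2⟩
    have hmI' : ((m : ℝ) + 1) / N ∈ Icc (0 : ℝ) 1 := ⟨by positivity, hm1⟩
    have e2 : ‖c m - G (γ t)‖ ≤ ε / 3 := by
      rw [← dist_eq_norm]
      refine hGδ _ hmI _ ht ?_
      rw [Real.dist_eq, abs_le]
      constructor <;> linarith
    have e3 : ‖c (m + 1) - c m‖ ≤ ε / 3 := by
      rw [← dist_eq_norm]
      simp only [hc, Nat.cast_add, Nat.cast_one]
      refine hGδ _ hmI' _ hmI ?_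
      rw [Real.dist_eq, hgap, abs_of_pos (by positivity)]
      exact hNδ.le
    calc ‖F (γ t) - G (γ t)‖ = ‖(c m - G (γ t)) + (c (m + 1) - c m) * R m t‖ := by
          rw [hsum]
          ring_nf
      _ ≤ ‖c m - G (γ t)‖ + ‖c (m + 1) - c m‖ * ‖R m t‖ := by
          rw [← norm_mul]
          exact norm_add_le _ _
      _ ≤ ε / 3 + ε / 3 * 2 := by
          gcongr
          exact (hR m hm).norm_le t
      _ = ε := by ring
  obtain ⟨F, hF, hFG⟩ := hA.exists_of_uniform_approx key
  rwa [← ContinuousMap.ext hFG]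

/-- Subtracting an element of `A` with the same values at the two ends, which is a constant if the
ends coincide, reduces to functions vanishing there. -/
theorem eq_top_of_isArcParam (hA : IsUniformAlgebra A)
    (hE : ∀ K ⊆ exceptionalSet A, IsClosed K → K.Countable) (hD : Dense (exceptionalSet A)ᶜ)
    (hγ : IsArcParam γ) : A = ⊤ := by
  rw [eq_top_iff]
  intro G _
  obtain ⟨a, ha, ha0, ha1⟩ : ∃ a ∈ A, a (γ 0) = G (γ 0) ∧ a (γ 1) = G (γ 1) := by
    rcases eq_or_ne (γ 0) (γ 1) with h | h
    · exact ⟨algebraMap ℂ _ (G (γ 0)), A.algebraMap_mem _, rfl, congrArg G h⟩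
    · exact hA.exists_separating h _ _
  have := mem_of_apply_eq_zero hA hE hD hγ (G := G - a) (by simp [ha0]) (by simp [ha1])
  simpa using A.add_mem ha this

end Approximation

/-! ### The interval and the circle -/

section Applications

theorem isArcParam_projIcc : IsArcParam (projIcc (0 : ℝ) 1 zero_le_one) where
  continuous := continuous_projIcc
  injOn := by
    intro s hs t ht h
    rw [projIcc_of_mem _ (Ioo_subset_Icc_self hs), projIcc_of_mem _ (Ioo_subset_Icc_self ht)] at h
    exact congrArg Subtype.val h
  isOpen_image := by
    intro U hU hUo
    have : projIcc (0 : ℝ) 1 zero_le_one '' U = Subtype.val ⁻¹' U := by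
      ext x
      constructor
      · rintro ⟨t, ht, rfl⟩
        rwa [mem_preimage, projIcc_of_mem _ (Ioo_subset_Icc_self (hU ht))]
      · exact fun hx => ⟨x, hx, projIcc_val _ x⟩
    rw [this]
    exact hUo.preimage continuous_subtype_val
  surj x := ⟨x, x.2, projIcc_val _ x⟩
  zero_notMem := by
    rintro ⟨t, ht, h⟩
    rw [projIcc_of_mem _ (Ioo_subset_Icc_self ht), projIcc_left] at h
    exact ht.1.ne (congrArg Subtype.val h).symm
  one_notMem := by
    rintro ⟨t, ht, h⟩
    rw [projIcc_of_mem _ (Ioo_subset_Icc_self ht), projIcc_right] at h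
    exact ht.2.ne (congrArg Subtype.val h)

/-- The circle, cut open at `1`. -/
theorem isArcParam_circleExp : IsArcParam fun t : ℝ => Circle.exp (2 * Real.pi * t) := by
  have hpi : (0 : ℝ) < 2 * Real.pi := Real.two_pi_pos
  have hsurj : ∀ x : Circle, ∃ t ∈ Ico (0 : ℝ) 1, Circle.exp (2 * Real.pi * t) = x := by
    intro x
    refine ⟨Int.fract (Complex.arg x / (2 * Real.pi)),
      ⟨Int.fract_nonneg _, Int.fract_lt_one _⟩, ?_⟩
    conv_rhs => rw [← Circle.exp_arg x]
    rw [Circle.exp_eq_exp]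
    refine ⟨-⌊Complex.arg x / (2 * Real.pi)⌋, ?_⟩
    rw [Int.fract]
    push_cast
    field_simp
    ring
  have hinj : InjOn (fun t : ℝ => Circle.exp (2 * Real.pi * t)) (Ico 0 1) := by
    intro s hs t ht h
    have := Circle.exp_injOn_Ico (a := 0) (b := 2 * Real.pi) (by simp)
      ⟨mul_nonneg hpi.le hs.1, by nlinarith [hs.2]⟩ ⟨mul_nonneg hpi.le ht.1, by nlinarith [ht.2]⟩ h
    exact mul_left_cancel₀ hpi.ne' this
  have h0 : Circle.exp (2 * Real.pi * 0) ∉ (fun t : ℝ => Circle.exp (2 * Real.pi * t)) '' Ioo 0 1 := by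
    rintro ⟨t, ht, h⟩
    exact ht.1.ne' (hinj (Ioo_subset_Ico_self ht) (left_mem_Ico.2 one_pos) h)
  refine ⟨by fun_prop, hinj.mono Ioo_subset_Ico_self, fun U _ hU => ?_, fun x => ?_, h0, ?_⟩
  · have hopen : IsOpenMap fun t : ℝ => Circle.exp (2 * Real.pi * t) :=
      Circle.isCoveringMap_exp.isOpenMap.comp
        (Homeomorph.mulLeft₀ (2 * Real.pi) hpi.ne').isOpenMap
    exact hopen U hU
  · obtain ⟨t, ht, h⟩ := hsurj x
    exact ⟨t, Ico_subset_Icc_self ht, h⟩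
  · simpa using h0

variable {X : Type*} [MetricSpace X] [CompactSpace X] {A : Subalgebra ℂ C(X, ℂ)} {γ : ℝ → X}

theorem eq_top_of_isMeagre (hA : IsUniformAlgebra A) (hγ : IsArcParam γ)
    (hm : IsMeagre (exceptionalSet A))
    (hP : ∀ P : Set X, P ⊆ exceptionalSet A → Perfect P → P = ∅) : A = ⊤ := by
  refine eq_top_of_isArcParam hA (fun K hK hKc => ?_) (dense_of_mem_residual hm) hγ
  by_contra hc
  obtain ⟨P, hPp, hne, hPK⟩ := exists_perfect_nonempty_of_isClosed_of_not_countable hKc hc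
  exact hne.ne_empty (hP P (hPK.trans hK) hPp)

theorem eq_top_of_countable [PerfectSpace X] (hA : IsUniformAlgebra A) (hγ : IsArcParam γ)
    (hc : (exceptionalSet A).Countable) : A = ⊤ := by
  have hm : IsMeagre (exceptionalSet A) := by
    rw [← biUnion_of_singleton (exceptionalSet A)]
    refine isMeagre_biUnion hc fun x _ => IsNowhereDense.isMeagre ?_
    rw [IsNowhereDense, closure_singleton, interior_singleton]
  exact eq_top_of_isArcParam hA (fun K hK _ => hc.mono hK) (dense_of_mem_residual hm) hγ

end Applications

end UniformAlgebra

theorem corollary12 :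
    (∀ A : Subalgebra ℂ C(unitInterval, ℂ), UniformAlgebra.IsUniformAlgebra A →
      ((IsMeagre (UniformAlgebra.exceptionalSet A) ∧
          (∀ P : Set unitInterval, P ⊆ UniformAlgebra.exceptionalSet A → Perfect P → P = ∅)) →
        A = ⊤) ∧
      ((UniformAlgebra.exceptionalSet A).Countable → A = ⊤)) ∧
    (∀ A : Subalgebra ℂ C(Circle, ℂ), UniformAlgebra.IsUniformAlgebra A →
      ((IsMeagre (UniformAlgebra.exceptionalSet A) ∧
          (∀ P : Set Circle, P ⊆ UniformAlgebra.exceptionalSet A → Perfect P → P = ∅)) →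
        A = ⊤) ∧
      ((UniformAlgebra.exceptionalSet A).Countable → A = ⊤)) := by
  have hI := UniformAlgebra.isArcParam_projIcc
  have hT := UniformAlgebra.isArcParam_circleExp
  have : Nontrivial Circle := ⟨1, Circle.exp Real.pi, fun h => by
    have := congrArg Subtype.val h
    norm_num [Circle.coe_exp, Complex.exp_pi_mul_I] at this⟩
  exact ⟨fun A hA => ⟨fun h => UniformAlgebra.eq_top_of_isMeagre hA hI h.1 h.2,
      UniformAlgebra.eq_top_of_countable hA hI⟩,
    fun A hA => ⟨fun h => UniformAlgebra.eq_top_of_isMeagre hA hT h.1 h.2,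
      UniformAlgebra.eq_top_of_countable hA hT⟩⟩
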